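/- **Setting.** An elementary type is a finite (possibly empty) product $A=A_1\cdots A_k$ of labelled non-trivial finite-dimensional quantum systems ($d_{A_i}\ge 2$), with Hilbert space $\mathcal H_A=\bigotimes_i\mathcal H_{A_i}$; the empty product is the trivial type $I$, $\mathcal H_I=\mathbb C$. Types are the elementary types and, for types $x,y$, the expressions $(x\to y)$. $\mathsf{Ele}_x$ is the set of non-trivial systems occurring in $x$; the systems of a type are labelled so that none occurs twice, and operators on $\mathcal H_x=\bigotimes_{S\in\mathsf{Ele}_x}\mathcal H_S$ are identified through these labels. Put $\overline x:=(x\to I)$ and $x\otimes y:=\overline{(x\to\overline y)}$. For an elementary type $E$ let $A\|E:=AE$ and $(x\to y)\|E:=(x\to y\|E)$. The sets $\mathsf T(x)$ of admissible maps and $\mathsf T_1(x)$ of deterministic maps, both subsets of $\mathcal L(\mathcal H_x)$, are defined recursively. For elementary $A$: $\mathsf T_1(A)=\{M\ge 0:\operatorname{Tr}M=1\}$ and $\mathsf T(A)=\{M\ge0:\ M\le N\text{ for some }N\in\mathsf T_1(A)\}$. For $M\in\mathcal L(\mathcal H_{x}\otimes\mathcal H_y)$, let $\mathcal M:\mathcal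 L(\mathcal H_x)\to\mathcal L(\mathcal H_y)$ be the linear map with Choi operator $M$. Say that $M$ preserves admissible (respectively deterministic) maps if, for every elementary type $E$ with new labels, $\mathcal M\otimes\mathcal I_E$ sends $\mathsf T(x\|E)$ into $\mathsf T(y\|E)$ (respectively $\mathsf T_1(x\|E)$ into $\mathsf T_1(y\|E)$). Then $M\in\mathsf T(x\to y)$ if $M$ preserves admissible maps and there are finitely many (possibly zero) $N_1,\dots,N_n$, each preserving admissible maps, such that $M+\sum_iN_i$ preserves deterministic maps; and $M\in\mathsf T_1(x\to y)$ if $M\in\mathsf T(x\to y)$ and $M$ preserves deterministic maps. A type $x$ is included in a type $y$, written $x\subseteq y$, if $\mathsf{Ele}_x=\mathsf{Ele}_y$ and $\mathsf T(x)\subseteq\mathsf T(y)$. **Proposition.** Let $x$ be a type. For $S\in\mathsf{Ele}_x$ let $K_x(S)\in\{0,1\}$ be the parity of the total number of arrows and open round brackets to the right of $S$ in the expression of $x$. Let $\mathsf{in}_x:=\{S\in\mathsf{Ele}_x: K_x(S)=1\}$ and $\mathsf{out}_x:=\mathsf{Ele}_x\setminus\mathsf{in}_x$, each regarded also as the elementary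 type that is the product of its members. Then $$\overline{\mathsf{out}_x\to\mathsf{in}_x}\ \subseteq\ x\ \subseteq\ \mathsf{in}_x\to\mathsf{out}_x ,\qquad\text{and also}\qquad \overline{\mathsf{in}_x}\otimes\mathsf{out}_x\ \subseteq\ x .$$ Moreover: 1. for every $\rho\ge0$ on $\mathcal H_{\mathsf{out}_x}$ with $\operatorname{Tr}\rho=1$, the map $I_{\mathsf{in}_x}\otimes\rho$ (discard the inputs, prepare $\rho$ on the outputs) belongs to $\mathsf T_1(x)$; 2. every $D\in\mathsf T_1(x)$ is the Choi operator of a channel from $\mathsf{in}_x$ to $\mathsf{out}_x$, that is, $D\ge0$ and $\operatorname{Tr}_{\mathsf{out}_x}D=I_{\mathsf{in}_x}$; 3. every $M\in\mathsf T(x)$ is the Choi operator of a quantum operation from $\mathsf{in}_x$ to $\mathsf{out}_x$, that is, $0\le M\le D$ for some Choi operator $D$ of a channel from $\mathsf{in}_x$ to $\mathsf{out}_x$. -/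

import Mathlib

open scoped ComplexOrder

namespace HOQT

/-- A labelled non-trivial quantum system: a label together with a dimension at least two.
There are infinitely many labelled copies of the system of each dimension. -/
structure QSystem where
  label : ℕ
  dim : ℕ
  one_lt_dim : 1 < dim
  deriving DecidableEq

/-- Elementary types are finite collections of labelled systems: the collection `A` stands for the
tensor product of its members, the product `AB` of `A` and `B` with no common label is the union
`A ∪ B`, and the trivial system `I` is the empty collection. -/
abbrev EleType := Finset QSystem

/-- Labels of the product orthonormal basis of `H_A = ⨂_{i ∈ A} ℂ^{dim i}`. -/
abbrev Config (A : EleType) : Type := (i : {i : QSystem // i ∈ A}) → Fin i.1.dim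

/-- The operators `L(H_A)`, as matrices in the product basis. -/
abbrev Op (A : EleType) : Type := Matrix (Config A) (Config A) ℂ

/-- The part of a basis label that concerns the systems in `A`. -/
def res {A B : EleType} (h : A ⊆ B) (b : Config B) : Config A := fun i => b ⟨i.1, h i.2⟩

/-- The basis label of `H_A ⊗ H_B = H_{AB}` with the given components (`A`, `B` disjoint). -/
def glue {A B : EleType} (a : Config A) (b : Config B) : Config (A ∪ B) := fun i =>
  if h : i.1 ∈ A then a ⟨i.1, h⟩ else b ⟨i.1, (Finset.mem_union.1 i.2).resolve_left h⟩

/-- The identification of `L(H_A)` and `L(H_B)` when `A` and `B` are the same set of systems. -/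
def castOp {A B : EleType} (h : A = B) (M : Op A) : Op B :=
  fun b b' => M (res h.subset b) (res h.subset b')

/-- The linear map `𝓜 : L(H_A) → L(H_B)`, `𝓜(ρ) = Tr_A[(ρᵀ ⊗ I_B) M]`, with Choi operator
`M ∈ L(H_A ⊗ H_B)`. -/
noncomputable def choiMap {A B : EleType} (M : Op (A ∪ B)) : Op A →ₗ[ℂ] Op B where
  toFun ρ := fun b b' => ∑ a, ∑ a', ρ a a' * M (glue a b) (glue a' b')
  map_add' ρ σ := by
    ext b b'
    change ∑ a, ∑ a', (ρ a a' + σ a a') * _ = (∑ a, ∑ a', ρ a a' * _) + ∑ a, ∑ a', σ a a' * _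
    simp [add_mul, Finset.sum_add_distrib]
  map_smul' c ρ := by
    ext b b'
    change ∑ a, ∑ a', (c * ρ a a') * _ = c * ∑ a, ∑ a', ρ a a' * _
    simp [Finset.mul_sum, mul_assoc]

/-- The map `f ⊗ 𝓘_E : L(H_A ⊗ H_E) → L(H_B ⊗ H_E)`: apply `f` to each of the blocks
`⟨e| ρ |e'⟩ ∈ L(H_A)` of `ρ`. -/
def amplify {A B : EleType} (f : Op A →ₗ[ℂ] Op B) (E : EleType) (ρ : Op (A ∪ E)) : Op (B ∪ E) :=
  fun v v' =>
    f (fun a a' => ρ (glue a (res Finset.subset_union_right v))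
        (glue a' (res Finset.subset_union_right v')))
      (res Finset.subset_union_left v) (res Finset.subset_union_left v')

/-- The hierarchy of types. -/
inductive Ty where
  | elem (A : EleType) : Ty
  | arrow (x y : Ty) : Ty

namespace Ty

/-- The set of the non-trivial elementary systems that occur in a type. -/
def ele : Ty → EleType
  | elem A => A
  | arrow x y => x.ele ∪ y.ele

/-- No label of a non-trivial system occurs more than once. -/
def NoRepetition : Ty → Prop
  | elem _ => True
  | arrow x y => x.NoRepetition ∧ y.NoRepetition ∧ Disjoint x.ele y.ele

/-- The trivial type `I`. -/
def triv : Ty := elem ∅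

/-- The type `x̄ = (x → I)`. -/
def bar (x : Ty) : Ty := arrow x triv

/-- The type `x ⊗ y`, the bar of `x → ȳ`. -/
def tensor (x y : Ty) : Ty := bar (arrow x (bar y))

/-- The extension `x || E`: `A || E = AE` and `(x → y) || E = (x → y || E)`. -/
def ext : Ty → EleType → Ty
  | elem A, E => elem (A ∪ E)
  | arrow x y, E => arrow x (y.ext E)

/-- The number of arrows. -/
def size : Ty → ℕ
  | elem _ => 0
  | arrow x y => x.size + y.size + 1

theorem ele_ext (x : Ty) (E : EleType) : (x.ext E).ele = x.ele ∪ E := by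
  induction x with
  | elem A => rfl
  | arrow x y _ ihy => simp [ext, ele, ihy, Finset.union_assoc]

theorem size_ext (x : Ty) (E : EleType) : (x.ext E).size = x.size := by
  induction x with
  | elem A => rfl
  | arrow x y _ ihy => simp [ext, size, ihy]

end Ty

/-- The operator `M` of type `x → y` is such that, for every elementary type `E` (with labels not
occurring in `x → y`), `𝓜 ⊗ 𝓘_E` sends each operator of the set `P E` of operators of type `x || E`
to the set `Q E` of operators of type `y || E`. -/
def CompletelySends (x y : Ty) (P : (E : EleType) → Set (Op (x.ext E).ele))
    (Q : (E : EleType) → Set (Op (y.ext E).ele)) (M : Op (x.ele ∪ y.ele)) : Prop :=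
  ∀ E : EleType, Disjoint (x.ele ∪ y.ele) E → ∀ ρ ∈ P E,
    castOp (y.ele_ext E).symm (amplify (choiMap M) E (castOp (x.ele_ext E) ρ)) ∈ Q E

/-- A pair of sets of operators: the admissible ones and the deterministic ones. -/
structure MapSets (A : EleType) where
  adm : Set (Op A)
  det : Set (Op A)

/-- The admissible and the deterministic maps of each type, by recursion on the type. -/
noncomputable def mapSets : (x : Ty) → MapSets x.ele
  | .elem A =>
    { adm := {M : Op A | M.PosSemidef ∧
        ∃ N : Op A, (N.PosSemidef ∧ N.trace = 1) ∧ (N - M).PosSemidef}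
      det := {M : Op A | M.PosSemidef ∧ M.trace = 1} }
  | .arrow x y =>
    let PreservesAdm : Op (x.ele ∪ y.ele) → Prop :=
      CompletelySends x y (fun E => (mapSets (x.ext E)).adm) (fun E => (mapSets (y.ext E)).adm)
    let PreservesDet : Op (x.ele ∪ y.ele) → Prop :=
      CompletelySends x y (fun E => (mapSets (x.ext E)).det) (fun E => (mapSets (y.ext E)).det)
    let Admissible : Op (x.ele ∪ y.ele) → Prop := fun M =>
      PreservesAdm M ∧ ∃ (n : ℕ) (N : Fin n → Op (x.ele ∪ y.ele)),
        (∀ i, PreservesAdm (N i)) ∧ PreservesDet (M + ∑ i, N i)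
    { adm := {M | Admissible M}
      det := {M | Admissible M ∧ PreservesDet M} }
termination_by x => x.size
decreasing_by all_goals (simp only [Ty.size_ext, Ty.size]; omega)

/-- The set `T(x)` of the admissible maps of type `x`. -/
noncomputable def admMaps (x : Ty) : Set (Op x.ele) := (mapSets x).adm

/-- The set `T₁(x)` of the deterministic maps of type `x`. -/
noncomputable def detMaps (x : Ty) : Set (Op x.ele) := (mapSets x).det

theorem mem_detMaps_elem {A : EleType} {M : Op A} :
    M ∈ detMaps (.elem A) ↔ M.PosSemidef ∧ M.trace = 1 := by
  rw [detMaps, mapSets]; rfl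

theorem mem_admMaps_elem {A : EleType} {M : Op A} :
    M ∈ admMaps (.elem A) ↔
      M.PosSemidef ∧ ∃ N : Op A, N ∈ detMaps (.elem A) ∧ (N - M).PosSemidef := by
  rw [admMaps, mapSets, detMaps, mapSets]; rfl

theorem mem_admMaps_arrow {x y : Ty} {M : Op (x.ele ∪ y.ele)} :
    M ∈ admMaps (.arrow x y) ↔
      CompletelySends x y (fun E => admMaps (x.ext E)) (fun E => admMaps (y.ext E)) M ∧
      ∃ (n : ℕ) (N : Fin n → Op (x.ele ∪ y.ele)),
        (∀ i, CompletelySends x y (fun E => admMaps (x.ext E)) (fun E => admMaps (y.ext E)) (N i)) ∧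
        CompletelySends x y (fun E => detMaps (x.ext E)) (fun E => detMaps (y.ext E))
          (M + ∑ i, N i) := by
  rw [admMaps, mapSets]; rfl

theorem mem_detMaps_arrow {x y : Ty} {M : Op (x.ele ∪ y.ele)} :
    M ∈ detMaps (.arrow x y) ↔ M ∈ admMaps (.arrow x y) ∧
      CompletelySends x y (fun E => detMaps (x.ext E)) (fun E => detMaps (y.ext E)) M := by
  rw [detMaps, admMaps, mapSets]; rfl

/-- The inclusion `x ⊆ y` of types: `T(x) ⊆ T(y)`. The two sets can only be compared when `x` and
`y` have the same elementary systems, so that `L(H_x) = L(H_y)`. -/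
def Included (x y : Ty) : Prop :=
  ∃ h : x.ele = y.ele, ∀ M ∈ admMaps x, castOp h M ∈ admMaps y

/-- The alphabet in which types are written. -/
inductive Token where
  | lpar : Token
  | rpar : Token
  | arrow : Token
  | sys (A : EleType) : Token

/-- The token is an elementary type that has the system `S` as a factor. -/
def Token.mentions (S : QSystem) : Token → Bool
  | .sys A => decide (S ∈ A)
  | _ => false

/-- The token is an arrow or an open bracket. -/
def Token.counts : Token → Bool
  | .arrow => true
  | .lpar => true
  | _ => false

namespace Ty

/-- The expression of a type, in which `x → y` is written `(x→y)`. -/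
def expr : Ty → List Token
  | elem A => [Token.sys A]
  | arrow x y => [Token.lpar] ++ x.expr ++ [Token.arrow] ++ y.expr ++ [Token.rpar]

/-- `K_x(S)`: the parity of the number of arrows and open brackets to the right of `S` in the
expression of `x`. -/
def K (x : Ty) (S : QSystem) : ℕ :=
  (x.expr.dropWhile (fun t => !t.mentions S)).countP Token.counts % 2

/-- The input systems of a type. -/
def inSys (x : Ty) : EleType := x.ele.filter (fun S => x.K S = 1)

/-- The output systems of a type. -/
def outSys (x : Ty) : EleType := x.ele \ x.inSys

theorem in_union_out (x : Ty) : x.inSys ∪ x.outSys = x.ele :=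
  Finset.union_sdiff_of_subset (Finset.filter_subset _ _)

end Ty

/-- `M` is the Choi operator of a channel from `A` to `B`: `M ≥ 0` and `Tr_B M = I_A`. -/
def IsChannel (A B : EleType) (M : Op (A ∪ B)) : Prop :=
  M.PosSemidef ∧
    (fun a a' => ∑ b : Config B, M (glue a b) (glue a' b) : Op A) = (1 : Op A)

/-- The operator `I_A ⊗ ρ`, the Choi operator of the map that discards `A` and prepares `ρ`. -/
noncomputable def discardPrepare (A : EleType) {B : EleType} (ρ : Op B) : Op (A ∪ B) :=
  fun v v' =>
    (1 : Op A) (res Finset.subset_union_left v) (res Finset.subset_union_left v') *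
      ρ (res Finset.subset_union_right v) (res Finset.subset_union_right v')

end HOQT

open HOQT

/-! Each type is treated through its deterministic maps, which are squeezed between two explicit
families: every map that discards the inputs and prepares a state on the outputs is deterministic,
and every deterministic map is a channel from inputs to outputs. The squeeze is proved by induction
on the number of arrows (`Good`, `good_arrow`). In `x → y` the inputs and outputs of `x` exchange
roles while those of `y` keep theirs. If `x → y` is given a discard-and-prepare operator,
contracting it with a channel of `x || E` yields a discard-and-prepare map of `y || E`
(`presDet_of_prep`). Conversely, feeding a deterministic map of `x → y` with the discard-and-prepare
maps of `x` yields channels of `y`, and these tests fix its partial trace (`chan_of_presDet`).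

The induction also carries three order facts: admissible maps are positive, each lies below a
deterministic one, and every positive operator below a deterministic one is admissible. Thus
admissible sets are determined by deterministic ones, and an inclusion of types reduces to an
inclusion of deterministic sets. Positivity comes from acting on half of an entangled vector
(`PresAdm.pk`).

For the two lower inclusions, a deterministic map of the left-hand type pairs to one with every
channel from outputs to inputs, and only discard-and-prepare operators do so (`prep_of_pairing`).

Operators are handled as kernels on labels of all systems at once, so the identification of
operators through system labels becomes equality of functions; tensor product is pointwise product
and application of a Choi operator is a pointwise product summed over the input labels. -/

namespace HOQT

/-! ### Operators as kernels: traces, contractions and supports -/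

/-- A basis label for every system at once. -/
abbrev Glob : Type := (S : QSystem) → Fin S.dim

/-- Matrix entries indexed by global basis labels. -/
abbrev Ker : Type := Glob → Glob → ℂ

/-- The part of a global label that concerns the systems in `A`. -/
def rst (A : EleType) (g : Glob) : Config A := fun i => g i.1

/-- Overwrite a global label on the systems in `A`. -/
def upd {A : EleType} (g : Glob) (a : Config A) : Glob := fun S =>
  if h : S ∈ A then a ⟨S, h⟩ else g S

/-- The global label that vanishes everywhere. -/
def base : Glob := fun S => ⟨0, lt_trans Nat.zero_lt_one S.one_lt_dim⟩

/-- Extend a label of `A` to a global one. -/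
def lift {A : EleType} (a : Config A) : Glob := upd base a

/-- The kernel of an operator. -/
def ker {A : EleType} (M : Op A) : Ker := fun g g' => M (rst A g) (rst A g')

/-- The operator on `A` with a given kernel. -/
def ofKer (A : EleType) (G : Ker) : Op A := fun a a' => G (lift a) (lift a')

/-- The partial trace over `A`. -/
def tr (A : EleType) (G : Ker) : Ker := fun g g' => ∑ a : Config A, G (upd g a) (upd g' a)

/-- The sum over all pairs of labels of `A`. -/
def sm (A : EleType) (G : Ker) : Ker := fun g g' =>
  ∑ a : Config A, ∑ a' : Config A, G (upd g a) (upd g' a')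

/-- The kernel of the identity operator on `A`. -/
def delta (A : EleType) : Ker := fun g g' => if rst A g = rst A g' then 1 else 0

/-- The kernel depends on the systems in `A` only. -/
def Dep (A : EleType) (G : Ker) : Prop :=
  ∀ g h g' h', rst A g = rst A h → rst A g' = rst A h' → G g g' = G h h'

variable {A B C : EleType} {G H : Ker}

theorem rst_eq_iff {g h : Glob} : rst A g = rst A h ↔ ∀ S ∈ A, g S = h S :=
  ⟨fun e S hS => congrFun e ⟨S, hS⟩, fun e => funext fun i => e i.1 i.2⟩

@[simp] theorem rst_upd (g : Glob) (a : Config A) : rst A (upd g a) = a := by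
  funext i; simp [rst, upd]

@[simp] theorem rst_lift (a : Config A) : rst A (lift a) = a := rst_upd _ _

theorem rst_upd_of_disjoint (h : Disjoint A B) (g : Glob) (b : Config B) :
    rst A (upd g b) = rst A g := by
  rw [rst_eq_iff]
  intro S hS
  simp [upd, Finset.disjoint_left.1 h hS]

@[simp] theorem upd_rst (g : Glob) : upd g (rst A g) = g := by
  funext S; simp [upd, rst]

theorem res_rst (h : A ⊆ B) (g : Glob) : res h (rst B g) = rst A g := rfl

theorem glue_rst (g : Glob) : glue (rst A g) (rst B g) = rst (A ∪ B) g := by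
  funext i; simp [glue, rst]

theorem upd_glue (h : Disjoint A B) (g : Glob) (a : Config A) (b : Config B) :
    upd g (glue a b) = upd (upd g a) b := by
  funext S
  by_cases hA : S ∈ A
  · have hB : S ∉ B := Finset.disjoint_left.1 h hA
    simp [upd, glue, hA, hB]
  · by_cases hB : S ∈ B <;> simp [upd, glue, hA, hB]

theorem upd_comm (h : Disjoint A B) (g : Glob) (a : Config A) (b : Config B) :
    upd (upd g a) b = upd (upd g b) a := by
  funext S
  by_cases hA : S ∈ A
  · have hB : S ∉ B := Finset.disjoint_left.1 h hA
    simp [upd, hA, hB]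
  · by_cases hB : S ∈ B <;> simp [upd, hA, hB]

/-- Labels of a union of disjoint collections are pairs of labels. -/
def glueEquiv (h : Disjoint A B) : Config A × Config B ≃ Config (A ∪ B) where
  toFun p := glue p.1 p.2
  invFun c := (res Finset.subset_union_left c, res Finset.subset_union_right c)
  left_inv p := by
    ext i
    · simp [res, glue, i.2]
    · simp [res, glue, Finset.disjoint_right.1 h i.2]
  right_inv c := by
    funext i; simp [glue, res]

theorem sum_union {R : Type*} [AddCommMonoid R] (h : Disjoint A B) (F : Config (A ∪ B) → R) :
    ∑ c, F c = ∑ a : Config A, ∑ b : Config B, F (glue a b) := by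
  rw [← (glueEquiv h).sum_comp, Fintype.sum_prod_type]; rfl

instance : Unique (Config (∅ : EleType)) where
  default := fun i => absurd i.2 (Finset.notMem_empty _)
  uniq _ := funext fun i => absurd i.2 (Finset.notMem_empty _)

@[simp] theorem upd_empty (g : Glob) (a : Config (∅ : EleType)) : upd g a = g := by
  funext S; simp [upd]

@[simp] theorem tr_empty (G : Ker) : tr ∅ G = G := by
  funext g g'; simp [tr]

@[simp] theorem delta_empty : delta ∅ = 1 := by
  funext g g'
  simp only [delta, Subsingleton.elim (rst ∅ g) (rst ∅ g'), if_true]; rfl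

theorem tr_union (h : Disjoint A B) (G : Ker) : tr (A ∪ B) G = tr A (tr B G) := by
  funext g g'; simp [tr, sum_union h, upd_glue h]

theorem sm_union (h : Disjoint A B) (G : Ker) : sm (A ∪ B) G = sm A (sm B G) := by
  funext g g'
  simp only [sm, sum_union h, upd_glue h]
  exact Finset.sum_congr rfl fun a _ => Finset.sum_comm

theorem tr_sm_comm (h : Disjoint A B) (G : Ker) : tr A (sm B G) = sm B (tr A G) := by
  funext g g'
  simp only [tr, sm, upd_comm h]
  rw [Finset.sum_comm]
  exact Finset.sum_congr rfl fun a _ => Finset.sum_comm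

theorem sm_comm (h : Disjoint A B) (G : Ker) : sm A (sm B G) = sm B (sm A G) := by
  rw [← sm_union h, ← sm_union h.symm, Finset.union_comm]

/-- Discarding a system is contraction with the identity. Together with `tr_mul` and `sm_mul`, which
pull out factors not involving the summed systems, this drives all the channel computations. -/
theorem sm_delta_mul (A : EleType) (G : Ker) : sm A (delta A * G) = tr A G := by
  funext g g'; simp [sm, tr, delta]

theorem delta_union (A B : EleType) : delta (A ∪ B) = delta A * delta B := by
  funext g g'
  have : rst (A ∪ B) g = rst (A ∪ B) g' ↔ rst A g = rst A g' ∧ rst B g = rst B g' := by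
    simp only [rst_eq_iff, Finset.mem_union]
    exact ⟨fun h => ⟨fun S hS => h S (.inl hS), fun S hS => h S (.inr hS)⟩,
      fun h S hS => hS.elim (h.1 S) (h.2 S)⟩
  simp only [delta, this, Pi.mul_apply]
  by_cases h1 : rst A g = rst A g' <;> by_cases h2 : rst B g = rst B g' <;> simp [h1, h2]

theorem Dep.mono (hG : Dep A G) (h : A ⊆ B) : Dep B G := fun g k g' k' e e' =>
  hG _ _ _ _ (by rw [← res_rst h, e, res_rst]) (by rw [← res_rst h, e', res_rst])

theorem Dep.mul (hG : Dep A G) (hH : Dep A H) : Dep A (G * H) := fun g k g' k' e e' => by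
  simp only [Pi.mul_apply, hG _ _ _ _ e e', hH _ _ _ _ e e']

theorem dep_delta (A : EleType) : Dep A (delta A) := fun g k g' k' e e' => by
  simp only [delta, e, e']

theorem dep_ker (M : Op A) : Dep A (ker M) := fun g k g' k' e e' => by
  simp only [ker, e, e']

theorem upd_congr {g k : Glob} (e : rst (B \ A) g = rst (B \ A) k) (a : Config A) :
    rst B (upd g a) = rst B (upd k a) := by
  rw [rst_eq_iff] at e ⊢
  intro S hS
  by_cases hA : S ∈ A
  · simp [upd, hA]
  · simp [upd, hA, e S (Finset.mem_sdiff.2 ⟨hS, hA⟩)]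

theorem Dep.sm (hG : Dep B G) : Dep (B \ A) (sm A G) := fun _ _ _ _ e e' =>
  Finset.sum_congr rfl fun a _ => Finset.sum_congr rfl fun a' _ =>
    hG _ _ _ _ (upd_congr e a) (upd_congr e' a')

theorem Dep.tr (hG : Dep B G) : Dep (B \ A) (tr A G) := fun _ _ _ _ e e' =>
  Finset.sum_congr rfl fun a _ => hG _ _ _ _ (upd_congr e a) (upd_congr e' a)

theorem Dep.upd (hG : Dep B G) (h : Disjoint B A) (g g' : Glob) (a a' : Config A) :
    G (upd g a) (upd g' a') = G g g' :=
  hG _ _ _ _ (rst_upd_of_disjoint h _ _) (rst_upd_of_disjoint h _ _)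

theorem tr_mul (hG : Dep B G) (h : Disjoint B A) (H : Ker) : tr A (G * H) = G * tr A H := by
  funext g g'
  simp [HOQT.tr, hG.upd h, Finset.mul_sum]

theorem sm_mul (hG : Dep B G) (h : Disjoint B A) (H : Ker) : sm A (G * H) = G * sm A H := by
  funext g g'
  simp [HOQT.sm, hG.upd h, Finset.mul_sum]

theorem tr_add (A : EleType) (G H : Ker) : tr A (G + H) = tr A G + tr A H := by
  funext g g'; simp [tr, Finset.sum_add_distrib]

theorem sm_add (A : EleType) (G H : Ker) : sm A (G + H) = sm A G + sm A H := by
  funext g g'; simp [sm, Finset.sum_add_distrib]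

theorem sm_sub (A : EleType) (G H : Ker) : sm A (G - H) = sm A G - sm A H := by
  funext g g'; simp [sm, Finset.sum_sub_distrib]

theorem tr_smul (A : EleType) (c : ℂ) (G : Ker) : tr A (c • G) = c • tr A G := by
  funext g g'; simp [tr, Finset.mul_sum]

theorem sm_smul (A : EleType) (c : ℂ) (G : Ker) : sm A (c • G) = c • sm A G := by
  funext g g'; simp [sm, Finset.mul_sum]

theorem tr_delta (A : EleType) : tr A (delta A) = (Fintype.card (Config A) : ℂ) • 1 := by
  funext g g'; simp [tr, delta]

theorem ker_ofKer (hG : Dep A G) : ker (ofKer A G) = G := by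
  funext g g'
  exact hG _ _ _ _ (rst_lift _) (rst_lift _)

@[simp] theorem ofKer_ker (M : Op A) : ofKer A (ker M) = M := by
  ext a a'; simp [ofKer, ker]

theorem ker_injective {M N : Op A} (h : ker M = ker N) : M = N := by
  rw [← ofKer_ker M, h, ofKer_ker]

@[simp] theorem ker_castOp (h : A = B) (M : Op A) : ker (castOp h M) = ker M := rfl

@[simp] theorem ker_add (M N : Op A) : ker (M + N) = ker M + ker N := rfl
@[simp] theorem ker_sub (M N : Op A) : ker (M - N) = ker M - ker N := rfl
@[simp] theorem ker_smul (c : ℂ) (M : Op A) : ker (c • M) = c • ker M := rfl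

theorem tr_ker (M : Op A) : tr A (ker M) = M.trace • 1 := by
  funext g g'; simp [tr, ker, Matrix.trace]

/-! ### Positivity of kernels -/

/-- The kernel is positive semidefinite: it has a finite Kraus form. -/
def PK (G : Ker) : Prop :=
  ∃ (ι : Type) (_ : Fintype ι) (w : ι → Glob → ℂ), ∀ g g', G g g' = ∑ k, w k g * star (w k g')

theorem PK.add (hG : PK G) (hH : PK H) : PK (G + H) := by
  obtain ⟨ι, _, w, hw⟩ := hG
  obtain ⟨κ, _, u, hu⟩ := hH
  exact ⟨ι ⊕ κ, inferInstance, Sum.elim w u, fun g g' => by simp [hw, hu]⟩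

/-- Schur product theorem: products of Kraus vectors form a Kraus family. With `PK.sm` it shows that
contractions of positive operators are positive. -/
theorem PK.mul (hG : PK G) (hH : PK H) : PK (G * H) := by
  obtain ⟨ι, _, w, hw⟩ := hG
  obtain ⟨κ, _, u, hu⟩ := hH
  refine ⟨ι × κ, inferInstance, fun p g => w p.1 g * u p.2 g, fun g g' => ?_⟩
  simp only [Pi.mul_apply, hw, hu, Fintype.sum_prod_type, Finset.sum_mul_sum, star_mul']
  exact Finset.sum_congr rfl fun i _ => Finset.sum_congr rfl fun j _ => by ring

theorem PK.sm (hG : PK G) : PK (sm A G) := by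
  obtain ⟨ι, _, w, hw⟩ := hG
  refine ⟨ι, inferInstance, fun k g => ∑ a : Config A, w k (HOQT.upd g a), fun g g' => ?_⟩
  simp only [HOQT.sm, hw, star_sum, Finset.sum_mul_sum]
  rw [Finset.sum_comm' (t' := Finset.univ) (s' := fun _ => Finset.univ) (by simp)]
  conv_rhs => rw [Finset.sum_comm]
  conv_rhs => enter [2, x]; rw [Finset.sum_comm]
  rw [Finset.sum_comm]

theorem pk_delta (A : EleType) : PK (delta A) := by
  refine ⟨Config A, inferInstance, fun c g => if rst A g = c then 1 else 0, fun g g' => ?_⟩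
  simp [delta, eq_comm]

theorem PK.tr (hG : PK G) : PK (tr A G) := by
  rw [← sm_delta_mul]; exact ((pk_delta A).mul hG).sm

theorem PK.smul (hG : PK G) {c : ℝ} (hc : 0 ≤ c) : PK ((c : ℂ) • G) := by
  obtain ⟨ι, _, w, hw⟩ := hG
  refine ⟨ι, inferInstance, fun k g => (Real.sqrt c : ℂ) * w k g, fun g g' => ?_⟩
  have : (c : ℂ) = Real.sqrt c * Real.sqrt c := by
    rw [← Complex.ofReal_mul, Real.mul_self_sqrt hc]
  simp only [Pi.smul_apply, smul_eq_mul, hw, Finset.mul_sum, star_mul', this]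
  refine Finset.sum_congr rfl fun k _ => ?_
  simp only [Complex.star_def, Complex.conj_ofReal]
  ring

theorem pk_outer (w : Glob → ℂ) : PK (fun g g' => w g * star (w g')) :=
  ⟨Unit, inferInstance, fun _ => w, by simp⟩

theorem pk_ker_iff {M : Op A} : PK (ker M) ↔ M.PosSemidef := by
  constructor
  · rintro ⟨ι, _, w, hw⟩
    have : M = ∑ k, Matrix.vecMulVec (fun a => w k (lift a)) (star fun a => w k (lift a)) := by
      ext a a'
      rw [Matrix.sum_apply]
      have := hw (lift a) (lift a')
      simpa [ker, Matrix.vecMulVec] using this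
    rw [this]
    exact Matrix.posSemidef_sum _ fun k _ => Matrix.posSemidef_vecMulVec_self_star _
  · intro h
    obtain ⟨m, v, rfl⟩ := Matrix.posSemidef_iff_eq_sum_vecMulVec.1 h
    refine ⟨Fin m, inferInstance, fun k g => v k (rst A g), fun g g' => ?_⟩
    simp [ker, Matrix.sum_apply, Matrix.vecMulVec]

/-! ### Application of Choi operators as contraction -/

/-- The operator on `F` obtained by contracting two operators on the systems in `A`. -/
def link (A : EleType) {C D : EleType} (F : EleType) (M : Op C) (ρ : Op D) : Op F :=
  ofKer F (sm A (ker ρ * ker M))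

theorem ker_link {D F : EleType} (M : Op C) (ρ : Op D) (hC : C ⊆ A ∪ F) (hD : D ⊆ A ∪ F) :
    ker (link A F M ρ) = sm A (ker ρ * ker M) := by
  refine ker_ofKer ((((dep_ker ρ).mono hD).mul ((dep_ker M).mono hC)).sm.mono ?_)
  intro S hS
  simp only [Finset.mem_sdiff, Finset.mem_union] at hS
  tauto

theorem castOp_amplify_choiMap {E D F : EleType} (hA : Disjoint A (B ∪ E)) (M : Op (A ∪ B))
    (hD : D = A ∪ E) (hF : B ∪ E = F) (ρ : Op D) :
    castOp hF (amplify (choiMap M) E (castOp hD ρ)) = link A F M ρ := by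
  subst hD hF
  apply ker_injective
  rw [ker_link _ _ (by intro S; simp; tauto) (by intro S; simp; tauto)]
  obtain ⟨hB, hE⟩ := Finset.disjoint_union_right.1 hA
  have glue_eq : ∀ {X : EleType}, Disjoint A X → ∀ (g : Glob) (a : Config A),
      glue a (rst X g) = rst (A ∪ X) (upd g a) := fun hX g a => by
    rw [← glue_rst, rst_upd, rst_upd_of_disjoint hX.symm]
  funext g g'
  simp only [ker, sm, castOp, res_rst, amplify, glue_eq hE, Pi.mul_apply]
  change ∑ a, ∑ a', _ * M (glue a (rst B g)) (glue a' (rst B g')) = _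
  simp only [glue_eq hB]

theorem completelySends_iff {x y : Ty} (hxy : Disjoint x.ele y.ele)
    {P : (E : EleType) → Set (Op (x.ext E).ele)} {Q : (E : EleType) → Set (Op (y.ext E).ele)}
    {M : Op (x.ele ∪ y.ele)} :
    CompletelySends x y P Q M ↔ ∀ E : EleType, Disjoint x.ele E → Disjoint y.ele E →
      ∀ ρ ∈ P E, link x.ele (y.ext E).ele M ρ ∈ Q E := by
  simp only [CompletelySends, Finset.disjoint_union_left]
  constructor
  · intro h E hx hy ρ hρ
    rw [← castOp_amplify_choiMap (Finset.disjoint_union_right.2 ⟨hxy, hx⟩) M (x.ele_ext E)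
      (y.ele_ext E).symm]
    exact h E ⟨hx, hy⟩ ρ hρ
  · intro h E hE ρ hρ
    rw [castOp_amplify_choiMap (Finset.disjoint_union_right.2 ⟨hxy, hE.1⟩)]
    exact h E hE.1 hE.2 ρ hρ

/-! ### Separation by pure states and domination by the identity -/

/-- A matrix whose sesquilinear form vanishes on the diagonal is zero. -/
theorem matrix_eq_zero_of_forall {n : Type*} [Fintype n] [DecidableEq n] {X : Matrix n n ℂ}
    (h : ∀ ψ : n → ℂ, ∑ a, ∑ a', ψ a * star (ψ a') * X a a' = 0) : X = 0 := by
  -- The form in `h` is `⟨ψ, Xᵀψ⟩`, whence the transpose; over `ℂ` such a quadratic form determines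
  -- its operator by polarization.
  have key : Matrix.toEuclideanLin X.transpose = 0 := by
    rw [← inner_map_self_eq_zero]
    intro ψ
    have := congrArg star (h (fun a => ψ a))
    rw [star_zero] at this
    simp only [star_sum, star_mul', star_star] at this
    rw [Finset.sum_comm] at this
    rw [← this]
    simp only [Matrix.toLpLin_apply, PiLp.inner_apply, RCLike.inner_apply, Matrix.mulVec,
      dotProduct, Matrix.transpose_apply, map_sum, map_mul, Finset.mul_sum, Complex.star_def]
    exact Finset.sum_congr rfl fun i _ => Finset.sum_congr rfl fun j _ => by ring
  have : X.transpose = 0 := by simpa using key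
  simpa using this

/-- Kernels on `A` and elsewhere that have the same contraction with all pure states are equal. -/
theorem ker_ext_of_pure (h : ∀ ψ : Config A → ℂ,
    sm A ((fun g g' => ψ (rst A g) * star (ψ (rst A g'))) * G) =
    sm A ((fun g g' => ψ (rst A g) * star (ψ (rst A g'))) * H)) : G = H := by
  funext g g'
  have : (fun a a' : Config A => G (upd g a) (upd g' a') - H (upd g a) (upd g' a') :
      Matrix _ _ ℂ) = 0 := by
    refine matrix_eq_zero_of_forall fun ψ => ?_
    have := congrFun (congrFun (h ψ) g) g'
    rw [← sub_eq_zero] at this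
    simpa [sm, ← Finset.sum_sub_distrib, ← mul_sub] using this
  have := congrFun (congrFun this (rst A g)) (rst A g')
  simpa [sub_eq_zero] using this

/-- A rank one operator is bounded by a multiple of the identity. -/
theorem exists_smul_one_sub_posSemidef {n : Type*} [Fintype n] [DecidableEq n]
    {M : Matrix n n ℂ} (hM : M.PosSemidef) :
    ∃ c : ℝ, 0 < c ∧ ((c : ℂ) • (1 : Matrix n n ℂ) - M).PosSemidef := by
  have rank_one : ∀ v : n → ℂ, ∃ c : ℝ, 0 ≤ c ∧
      ((c : ℂ) • (1 : Matrix n n ℂ) - Matrix.vecMulVec v (star v)).PosSemidef := by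
    intro v
    set V := Matrix.vecMulVec v (star v)
    have hV : V.PosSemidef := Matrix.posSemidef_vecMulVec_self_star v
    set t : ℝ := ∑ i, Complex.normSq (v i)
    have ht : star v ⬝ᵥ v = (t : ℂ) := by
      simp [t, dotProduct, Complex.normSq_eq_conj_mul_self]
    have hVV : V * V = (t : ℂ) • V := by
      rw [Matrix.vecMulVec_mul_vecMulVec, ht]
      ext i j
      simp [V, Matrix.vecMulVec]
      ring
    have ht0 : 0 ≤ t := Finset.sum_nonneg fun i _ => Complex.normSq_nonneg _
    refine ⟨t, ht0, ?_⟩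
    rcases ht0.eq_or_lt with h | h
    · have : v = 0 := by
        funext i
        have := (Finset.sum_eq_zero_iff_of_nonneg fun i _ => Complex.normSq_nonneg (v i)).1 h.symm i
          (Finset.mem_univ i)
        simpa using this
      have hV0 : V = 0 := by simp [V, this]
      simp [← h, hV0, Matrix.PosSemidef.zero]
    -- Since `V² = tV`, the self-adjoint matrix `W = t - V` satisfies `W² = tW`, so it is `t⁻¹`
    -- times a square.
    · have sq : (t : ℂ) • (1 : Matrix n n ℂ) - V =
          ((t⁻¹ : ℝ) : ℂ) • (((t : ℂ) • (1 : Matrix n n ℂ) - V).conjTranspose *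
            ((t : ℂ) • (1 : Matrix n n ℂ) - V)) := by
        have ht' : (t : ℂ) ≠ 0 := by exact_mod_cast h.ne'
        rw [Matrix.conjTranspose_sub, Matrix.conjTranspose_smul, hV.1.eq, Matrix.conjTranspose_one,
          Complex.star_def, Complex.conj_ofReal, sub_mul, mul_sub, mul_sub, hVV]
        simp only [Matrix.smul_mul, Matrix.mul_smul, one_smul, Matrix.mul_one, sub_self,
          sub_zero, smul_sub, smul_smul, Complex.ofReal_inv, ← mul_assoc, inv_mul_cancel₀ ht',
          one_mul]
      rw [sq]
      exact (Matrix.posSemidef_conjTranspose_mul_self _).smul (by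
        exact_mod_cast (inv_nonneg.2 ht0))
  obtain ⟨m, v, rfl⟩ := Matrix.posSemidef_iff_eq_sum_vecMulVec.1 hM
  choose c hc hcv using fun i => rank_one (v i)
  -- The extra `1` keeps the constant strictly positive, so that it can be inverted later.
  refine ⟨1 + ∑ i, c i, by have := Finset.sum_nonneg fun i (_ : i ∈ Finset.univ) => hc i
                           linarith, ?_⟩
  have : ((1 + ∑ i, c i : ℝ) : ℂ) • (1 : Matrix n n ℂ) - ∑ i, Matrix.vecMulVec (v i) (star (v i)) =
      1 + ∑ i, ((c i : ℂ) • (1 : Matrix n n ℂ) - Matrix.vecMulVec (v i) (star (v i))) := by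
    rw [Finset.sum_sub_distrib, ← Finset.sum_smul]
    push_cast
    rw [add_smul, one_smul, add_sub_assoc]
  rw [this]
  exact Matrix.PosSemidef.one.add (Matrix.posSemidef_sum _ fun i _ => hcv i)

end HOQT

/-! ### Parity of brackets and arrows: inputs and outputs -/

namespace HOQT
namespace Ty

theorem exists_mentions_expr {x : Ty} {S : QSystem} (h : S ∈ x.ele) :
    ∃ t ∈ x.expr, t.mentions S = true := by
  induction x with
  | elem A => exact ⟨_, List.mem_singleton_self _, by simpa [Token.mentions, ele] using h⟩
  | arrow x y hx hy =>
    rcases Finset.mem_union.1 h with h | h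
    · obtain ⟨t, ht, h⟩ := hx h; exact ⟨t, by simp [expr, ht], h⟩
    · obtain ⟨t, ht, h⟩ := hy h; exact ⟨t, by simp [expr, ht], h⟩

theorem not_mentions_expr {x : Ty} {S : QSystem} (h : S ∉ x.ele) :
    ∀ t ∈ x.expr, t.mentions S = false := by
  induction x with
  | elem A => simpa [expr, Token.mentions, ele] using h
  | arrow x y hx hy =>
    simp only [ele, Finset.mem_union, not_or] at h
    intro t ht
    simp only [expr, List.mem_append, List.mem_singleton] at ht
    rcases ht with (((rfl | ht) | rfl) | ht) | rfl
    · rfl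
    · exact hx h.1 t ht
    · rfl
    · exact hy h.2 t ht
    · rfl

/-- Each composite type contributes one arrow and one open bracket. Hence, for a system in `x`,
passing to `x → y` adds just the central arrow modulo two, which flips its parity. -/
theorem countP_expr (x : Ty) : x.expr.countP Token.counts % 2 = 0 := by
  induction x with
  | elem A => rfl
  | arrow x y hx hy =>
    simp [expr, List.countP_append, List.countP_cons, Token.counts]
    omega

theorem dropWhile_append_of_mem {x : Ty} {S : QSystem} (h : S ∈ x.ele) (l : List Token) :
    (x.expr ++ l).dropWhile (fun t => !t.mentions S) =
      x.expr.dropWhile (fun t => !t.mentions S) ++ l := by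
  rw [List.dropWhile_append, if_neg]
  obtain ⟨t, ht, h⟩ := exists_mentions_expr h
  rw [List.isEmpty_iff, List.dropWhile_eq_nil_iff]
  intro h'
  simpa [h] using h' t ht

theorem dropWhile_append_of_notMem {x : Ty} {S : QSystem} (h : S ∉ x.ele) (l : List Token) :
    (x.expr ++ l).dropWhile (fun t => !t.mentions S) = l.dropWhile (fun t => !t.mentions S) := by
  rw [List.dropWhile_append_of_pos]
  intro t ht
  simp [not_mentions_expr h t ht]

theorem K_elem (A : EleType) (S : QSystem) : (elem A).K S = 0 := by
  by_cases h : S ∈ A <;> simp [K, expr, List.dropWhile, Token.mentions, h, Token.counts]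

theorem K_arrow_left {x y : Ty} {S : QSystem} (h : S ∈ x.ele) :
    (arrow x y).K S = (x.K S + 1) % 2 := by
  have := countP_expr y
  simp only [K, expr, List.append_assoc]
  rw [List.cons_append, List.nil_append, List.dropWhile_cons_of_pos (by rfl),
    dropWhile_append_of_mem h]
  simp [List.countP_append, List.countP_cons, Token.counts]
  omega

theorem K_arrow_right {x y : Ty} {S : QSystem} (h : S ∉ x.ele) (hy : S ∈ y.ele) :
    (arrow x y).K S = y.K S := by
  simp only [K, expr, List.append_assoc]
  rw [List.cons_append, List.nil_append, List.dropWhile_cons_of_pos (by rfl),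
    dropWhile_append_of_notMem h, List.cons_append, List.nil_append,
    List.dropWhile_cons_of_pos (by rfl), dropWhile_append_of_mem hy]
  simp [List.countP_append, Token.counts]

theorem inSys_subset (x : Ty) : x.inSys ⊆ x.ele := Finset.filter_subset _ _

theorem outSys_subset (x : Ty) : x.outSys ⊆ x.ele := Finset.sdiff_subset

theorem disjoint_in_out (x : Ty) : Disjoint x.inSys x.outSys := Finset.disjoint_sdiff

theorem mem_outSys {x : Ty} {S : QSystem} : S ∈ x.outSys ↔ S ∈ x.ele ∧ x.K S ≠ 1 := by
  simp only [outSys, inSys, Finset.mem_sdiff, Finset.mem_filter]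
  tauto

theorem inSys_elem (A : EleType) : (elem A).inSys = ∅ := by
  simp [inSys, K_elem]

theorem outSys_elem (A : EleType) : (elem A).outSys = A := by
  simp [outSys, inSys_elem, ele]

theorem inSys_arrow {x y : Ty} (h : Disjoint x.ele y.ele) :
    (arrow x y).inSys = x.outSys ∪ y.inSys := by
  ext S
  have hK : x.K S < 2 := Nat.mod_lt _ two_pos
  simp only [inSys, Finset.mem_filter, Finset.mem_union, mem_outSys, ele]
  by_cases hx : S ∈ x.ele
  · simp only [hx, Finset.disjoint_left.1 h hx, K_arrow_left hx]
    simp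
    omega
  · by_cases hy : S ∈ y.ele
    · simp [hx, hy, K_arrow_right hx hy]
    · simp [hx, hy]

theorem outSys_arrow {x y : Ty} (h : Disjoint x.ele y.ele) :
    (arrow x y).outSys = x.inSys ∪ y.outSys := by
  ext S
  have hK : x.K S < 2 := Nat.mod_lt _ two_pos
  simp only [inSys, Finset.mem_filter, Finset.mem_union, mem_outSys, ele]
  by_cases hx : S ∈ x.ele
  · simp only [hx, Finset.disjoint_left.1 h hx, K_arrow_left hx]
    simp
    omega
  · by_cases hy : S ∈ y.ele
    · simp [hx, hy, K_arrow_right hx hy]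
    · simp [hx, hy]

theorem NoRepetition.ext {x : Ty} (hx : x.NoRepetition) {E : EleType} (h : Disjoint x.ele E) :
    (x.ext E).NoRepetition := by
  induction x with
  | elem A => trivial
  | arrow x y _ hy =>
    obtain ⟨h1, h2⟩ := Finset.disjoint_union_left.1 h
    refine ⟨hx.1, hy hx.2.1 h2, ?_⟩
    rw [ele_ext]
    exact Finset.disjoint_union_right.2 ⟨hx.2.2, h1⟩

theorem inSys_ext {x : Ty} (hx : x.NoRepetition) {E : EleType} (h : Disjoint x.ele E) :
    (x.ext E).inSys = x.inSys := by
  induction x with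
  | elem A => simp [Ty.ext, inSys_elem]
  | arrow x y _ hy =>
    obtain ⟨h1, h2⟩ := Finset.disjoint_union_left.1 h
    rw [Ty.ext, inSys_arrow hx.2.2, inSys_arrow (hx.ext h).2.2, hy hx.2.1 h2]

theorem outSys_ext {x : Ty} (hx : x.NoRepetition) {E : EleType} (h : Disjoint x.ele E) :
    (x.ext E).outSys = x.outSys ∪ E := by
  induction x with
  | elem A => simp [Ty.ext, outSys_elem]
  | arrow x y _ hy =>
    obtain ⟨h1, h2⟩ := Finset.disjoint_union_left.1 h
    rw [Ty.ext, outSys_arrow hx.2.2, outSys_arrow (hx.ext h).2.2, hy hx.2.1 h2,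
      Finset.union_assoc]

end Ty
-- Channels, preparations and the induction hypothesis
theorem ker_one (A : EleType) : ker (1 : Op A) = delta A := by
  funext g g'; simp [ker, delta, Matrix.one_apply]

theorem card_config_pos (A : EleType) : 0 < Fintype.card (Config A) :=
  Fintype.card_pos_iff.2 ⟨rst A base⟩

theorem PK.comp (hG : PK G) (f : Glob → Glob) : PK (fun g g' => G (f g) (f g')) := by
  obtain ⟨ι, _, w, hw⟩ := hG
  exact ⟨ι, inferInstance, fun k g => w k (f g), fun g g' => hw _ _⟩

/-- Kernels that have the same contraction with all states of `A` are equal. -/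
theorem ker_ext_of_states (h : ∀ τ : Op A, τ.PosSemidef → τ.trace = 1 →
    sm A (ker τ * G) = sm A (ker τ * H)) : G = H := by
  refine ker_ext_of_pure (A := A) fun ψ => ?_
  set V : Op A := Matrix.vecMulVec ψ (star ψ) with hVdef
  have hV : V.PosSemidef := Matrix.posSemidef_vecMulVec_self_star ψ
  have hker : (fun g g' => ψ (rst A g) * star (ψ (rst A g')) : Ker) = ker V := by
    funext g g'; simp [ker, V, Matrix.vecMulVec]
  rw [hker]
  set t : ℝ := ∑ i, Complex.normSq (ψ i)
  have ht : V.trace = (t : ℂ) := by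
    simp [V, t, Matrix.trace, Matrix.vecMulVec, Complex.normSq_eq_conj_mul_self, mul_comm]
  have ht0 : 0 ≤ t := Finset.sum_nonneg fun i _ => Complex.normSq_nonneg _
  rcases ht0.eq_or_lt with h0 | h0
  · have : V = 0 := by
      rw [← hV.trace_eq_zero_iff, ht, ← h0, Complex.ofReal_zero]
    have hz : ker V = 0 := by rw [this]; rfl
    simp [hz]
  · have ht' : (t : ℂ) ≠ 0 := by exact_mod_cast h0.ne'
    have key := h ((t : ℂ)⁻¹ • V)
      (hV.smul (by rw [← Complex.ofReal_inv]; exact_mod_cast inv_nonneg.2 ht0))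
      (by rw [Matrix.trace_smul, ht, smul_eq_mul, inv_mul_cancel₀ ht'])
    rw [ker_smul, smul_mul_assoc, smul_mul_assoc, sm_smul, sm_smul] at key
    exact smul_right_injective _ (inv_ne_zero ht') key

/-- The kernel of a channel from `I` to `O`. -/
def Chan (I O : EleType) (G : Ker) : Prop := PK G ∧ tr O G = delta I

/-- The kernel of a channel that discards `I` and prepares a state of `O`. -/
def Prep (I O : EleType) (G : Ker) : Prop :=
  ∃ ρ : Op O, ρ.PosSemidef ∧ ρ.trace = 1 ∧ G = delta I * ker ρ

/-- The conclusions of the induction on types. -/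
structure Good (z : Ty) : Prop where
  prep : ∀ D : Op z.ele, Prep z.inSys z.outSys (ker D) → D ∈ detMaps z
  chan : ∀ D ∈ detMaps z, Chan z.inSys z.outSys (ker D)
  pos : ∀ M ∈ admMaps z, PK (ker M)
  bound : ∀ M ∈ admMaps z, ∃ D ∈ detMaps z, PK (ker D - ker M)
  hered : ∀ D ∈ detMaps z, ∀ M : Op z.ele, PK (ker M) → PK (ker D - ker M) → M ∈ admMaps z

theorem good_elem (A : EleType) : Good (.elem A) where
  prep := by
    rw [Ty.inSys_elem, Ty.outSys_elem]
    rintro D ⟨ρ, h1, h2, h3⟩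
    rw [delta_empty, one_mul] at h3
    obtain rfl : D = ρ := ker_injective h3
    exact mem_detMaps_elem.2 ⟨h1, h2⟩
  chan := by
    rw [Ty.inSys_elem, Ty.outSys_elem]
    intro (D : Op A) hD
    obtain ⟨h1, h2⟩ := mem_detMaps_elem.1 hD
    refine ⟨pk_ker_iff.2 h1, ?_⟩
    rw [delta_empty]
    exact (tr_ker D).trans (by rw [h2, one_smul])
  pos := fun M hM => pk_ker_iff.2 (mem_admMaps_elem.1 hM).1
  bound := by
    intro M hM
    obtain ⟨_, N, hN, h⟩ := mem_admMaps_elem.1 hM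
    exact ⟨N, hN, pk_ker_iff.2 h⟩
  hered := fun D hD M h1 h2 => mem_admMaps_elem.2 ⟨pk_ker_iff.1 h1, D, hD, pk_ker_iff.1 h2⟩

theorem sm_ele (x : Ty) (G : Ker) : sm x.ele G = sm x.inSys (sm x.outSys G) := by
  rw [← x.in_union_out, sm_union x.disjoint_in_out]

/-! ### The induction step for `x → y` -/

section Arrow

variable {x y : Ty}

/-- The operator preserves the admissible maps. -/
def PresAdm (x y : Ty) (M : Op (x.ele ∪ y.ele)) : Prop :=
  CompletelySends x y (fun E => admMaps (x.ext E)) (fun E => admMaps (y.ext E)) M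

/-- The operator preserves the deterministic maps. -/
def PresDet (x y : Ty) (M : Op (x.ele ∪ y.ele)) : Prop :=
  CompletelySends x y (fun E => detMaps (x.ext E)) (fun E => detMaps (y.ext E)) M

theorem ker_link_ext {E : EleType} (M : Op (x.ele ∪ y.ele)) (ρ : Op (x.ext E).ele) :
    ker (link x.ele (y.ext E).ele M ρ) = sm x.ele (ker ρ * ker M) := by
  apply ker_link <;> intro S <;> simp only [Ty.ele_ext, Finset.mem_union] <;> tauto

theorem exists_fresh (A : EleType) (n : ℕ) (hn : 1 < n) :
    ∃ s : QSystem, s.dim = n ∧ s ∉ A := by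
  refine ⟨⟨A.sup QSystem.label + 1, n, hn⟩, rfl, fun h => ?_⟩
  exact absurd (Finset.le_sup (f := QSystem.label) h) (Nat.not_succ_le_self _)

/-- Small multiples of positive operators are admissible. -/
theorem Good.exists_smul_mem {z : Ty} (hz : Good z) {M : Op z.ele} (hM : PK (ker M)) :
    ∃ ε : ℝ, 0 < ε ∧ (ε : ℂ) • M ∈ admMaps z := by
  obtain ⟨c, hc, hcM⟩ := exists_smul_one_sub_posSemidef (pk_ker_iff.1 hM)
  set d : ℝ := ((Fintype.card (Config z.outSys) : ℕ) : ℝ)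
  have hd : 0 < d := Nat.cast_pos.2 (card_config_pos _)
  have hd' : (d : ℂ) ≠ 0 := by exact_mod_cast hd.ne'
  have hc' : (c : ℂ) ≠ 0 := by exact_mod_cast hc.ne'
  -- Discarding the inputs and preparing the maximally mixed state; it dominates `M / (d c)`.
  have hP : ((d⁻¹ : ℝ) : ℂ) • (1 : Op z.ele) ∈ detMaps z := by
    refine hz.prep _ ⟨((d⁻¹ : ℝ) : ℂ) • 1,
      Matrix.PosSemidef.one.smul (by exact_mod_cast inv_nonneg.2 hd.le), ?_, ?_⟩
    · rw [Matrix.trace_smul, Matrix.trace_one, smul_eq_mul]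
      simp only [Complex.ofReal_inv, d, Complex.ofReal_natCast]
      exact inv_mul_cancel₀ (by simpa [d] using hd')
    · rw [ker_smul, ker_smul, ker_one, ker_one, mul_smul_comm, ← delta_union, z.in_union_out]
  refine ⟨(d * c)⁻¹, by positivity, hz.hered _ hP _ ?_ ?_⟩
  · rw [ker_smul]; exact hM.smul (by positivity)
  · have : ker (((d⁻¹ : ℝ) : ℂ) • (1 : Op z.ele)) - ker ((((d * c)⁻¹ : ℝ) : ℂ) • M) =
        (((d * c)⁻¹ : ℝ) : ℂ) • ker ((c : ℂ) • (1 : Op z.ele) - M) := by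
      rw [ker_sub, smul_sub, ker_smul, ker_smul, ker_smul, smul_smul]
      congr 2
      push_cast
      field_simp
    rw [this]
    exact (pk_ker_iff.2 hcM).smul (by positivity)

/-- Choi's argument: the map is applied to half of an unnormalised maximally entangled vector,
scaled down until admissible; the positive result contains the Choi operator as a compression. -/
theorem PresAdm.pk (hxy : Disjoint x.ele y.ele)
    (hx : ∀ E, Disjoint x.ele E → Good (x.ext E)) (hy : ∀ E, Disjoint y.ele E → Good (y.ext E))
    {M : Op (x.ele ∪ y.ele)} (hM : PresAdm x y M) : PK (ker M) := by
  -- One ancilla is enough. The `+ 1` makes its dimension at least two even when `x` has no systems.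
  obtain ⟨s, hs, hsxy⟩ := exists_fresh (x.ele ∪ y.ele) (Fintype.card (Config x.ele) + 1)
    (by have := card_config_pos x.ele; omega)
  obtain ⟨hsx, hsy⟩ : s ∉ x.ele ∧ s ∉ y.ele := by simpa using hsxy
  have hEx : Disjoint x.ele {s} := Finset.disjoint_singleton_right.2 hsx
  have hEy : Disjoint y.ele {s} := Finset.disjoint_singleton_right.2 hsy
  obtain ⟨ι, hι⟩ : ∃ ι : Config x.ele → Fin s.dim, Function.Injective ι := by
    rw [hs]
    exact ⟨fun a => (Fintype.equivFin _ a).castSucc,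
      (Fin.castSucc_injective _).comp (Fintype.equivFin _).injective⟩
  let r : Glob → ℂ := fun g => if ι (rst x.ele g) = g s then 1 else 0
  have hr : Dep (x.ext {s}).ele (fun g g' => r g * star (r g')) := by
    have : ∀ g h, rst (x.ext {s}).ele g = rst (x.ext {s}).ele h → r g = r h := by
      intro g h e
      have e1 : rst x.ele g = rst x.ele h := by
        rw [rst_eq_iff] at e ⊢
        exact fun S hS => e S (by simp [Ty.ele_ext, hS])
      have e2 : g s = h s := rst_eq_iff.1 e s (by simp [Ty.ele_ext])
      simp only [r, e1, e2]
    intro g h g' h' e e'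
    simp only [this _ _ e, this _ _ e']
  let Φ : Op (x.ext {s}).ele := ofKer _ (fun g g' => r g * star (r g'))
  have hΦ : ker Φ = fun g g' => r g * star (r g') := ker_ofKer hr
  obtain ⟨ε, hε, hadm⟩ := (hx _ hEx).exists_smul_mem (M := Φ) (by rw [hΦ]; exact pk_outer r)
  have key := (hy _ hEy).pos _ ((completelySends_iff hxy).1 hM _ hEx hEy _ hadm)
  rw [ker_link_ext, ker_smul, smul_mul_assoc, sm_smul] at key
  -- Setting the ancilla label to `ι` of the `x`-label leaves a single term of each sum, the wanted
  -- entry of `M`.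
  have key := (key.smul (inv_nonneg.2 hε.le)).comp
    (fun g => Function.update g s (ι (rst x.ele g)))
  convert key using 1
  funext g g'
  have hε' : (ε : ℂ) ≠ 0 := by exact_mod_cast hε.ne'
  have upd_s : ∀ (g : Glob) (a : Config x.ele), upd g a s = g s := fun g a => by
    simp [upd, hsx]
  have hU : ∀ g : Glob, rst (x.ele ∪ y.ele)
      (upd (Function.update g s (ι (rst x.ele g))) (rst x.ele g)) = rst (x.ele ∪ y.ele) g := by
    intro g
    rw [rst_eq_iff]
    intro S hS
    have : S ≠ s := fun h => hsxy (h ▸ hS)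
    by_cases h : S ∈ x.ele <;> simp [upd, h, rst, this]
  simp [hΦ, sm, r, upd_s, hι.eq_iff, hε']
  simp [ker, hU]

/-- If `ρ ≤ σ` with `σ` deterministic, the image of `ρ` under `M` lies below the deterministic image
of `σ` under `D`, because `σD - ρM = σ(D - M) + (σ - ρ)M`. -/
theorem PresDet.presAdm_of_le (hxy : Disjoint x.ele y.ele)
    (hx : ∀ E, Disjoint x.ele E → Good (x.ext E)) (hy : ∀ E, Disjoint y.ele E → Good (y.ext E))
    {D : Op (x.ele ∪ y.ele)} (hD : PresDet x y D) {M : Op (x.ele ∪ y.ele)} (hM : PK (ker M))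
    (hDM : PK (ker D - ker M)) : PresAdm x y M := by
  refine (completelySends_iff hxy).2 fun E hEx hEy ρ hρ => ?_
  obtain ⟨σ, hσ, hle⟩ := (hx E hEx).bound ρ hρ
  refine (hy E hEy).hered _ ((completelySends_iff hxy).1 hD E hEx hEy σ hσ) _ ?_ ?_
  · rw [ker_link_ext]
    exact (((hx E hEx).pos ρ hρ).mul hM).sm
  · rw [ker_link_ext, ker_link_ext, ← sm_sub]
    have : ker σ * ker D - ker ρ * ker M =
        ker σ * (ker D - ker M) + (ker σ - ker ρ) * ker M := by ring
    rw [this]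
    exact ((((hx E hEx).chan σ hσ).1.mul hDM).add (hle.mul hM)).sm

theorem mem_detMaps_of_presDet (hxy : Disjoint x.ele y.ele)
    (hx : ∀ E, Disjoint x.ele E → Good (x.ext E)) (hy : ∀ E, Disjoint y.ele E → Good (y.ext E))
    {D : Op (x.ele ∪ y.ele)} (hD : PresDet x y D) (h : PK (ker D)) : D ∈ detMaps (.arrow x y) := by
  refine mem_detMaps_arrow.2 ⟨mem_admMaps_arrow.2
    ⟨hD.presAdm_of_le hxy hx hy h ?_, 0, Fin.elim0, fun i => i.elim0, ?_⟩, hD⟩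
  · rw [sub_self]
    simpa using h.smul le_rfl
  · simpa only [Finset.univ_eq_empty, Finset.sum_empty, add_zero] using! hD

theorem presDet_of_prep (hxN : x.NoRepetition) (hyN : y.NoRepetition)
    (hxy : Disjoint x.ele y.ele)
    (hx : ∀ E, Disjoint x.ele E → Good (x.ext E)) (hy : ∀ E, Disjoint y.ele E → Good (y.ext E))
    {M : Op (x.ele ∪ y.ele)} {ρ : Op (x.inSys ∪ y.outSys)} (hρ : ρ.PosSemidef) (hρ1 : ρ.trace = 1)
    (hM : ker M = delta (x.outSys ∪ y.inSys) * ker ρ) : PresDet x y M := by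
  refine (completelySends_iff hxy).2 fun E hEx hEy D hD => (hy E hEy).prep _ ?_
  have hch := (hx E hEx).chan D hD
  rw [Ty.inSys_ext hxN hEx, Ty.outSys_ext hxN hEx] at hch
  rw [Ty.inSys_ext hyN hEy, Ty.outSys_ext hyN hEy, ker_link_ext, hM, delta_union]
  have dxx := x.disjoint_in_out
  have hyi_x : Disjoint y.inSys x.ele := (hxy.mono_right y.inSys_subset).symm
  have hyo_x : Disjoint y.outSys x.ele := (hxy.mono_right y.outSys_subset).symm
  -- `T` is the state prepared on the outputs of `y || E`; the factor `delta y.inSys` stays outside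
  -- the contraction. Its trace is one because `E` counts among the outputs of `x || E`, so tracing
  -- these out of the channel `D` leaves the identity on the inputs of `x`, and then only `Tr ρ`
  -- remains.
  set T : Ker := sm x.ele (delta x.outSys * (ker ρ * ker D)) with hT
  have hTdep : Dep (y.outSys ∪ E) T := by
    have hD' : Dep (x.ele ∪ (y.outSys ∪ E)) (ker D) := (dep_ker D).mono (by
      rw [Ty.ele_ext]; intro S; simp only [Finset.mem_union]; tauto)
    have hρ' : Dep (x.ele ∪ (y.outSys ∪ E)) (ker ρ) := (dep_ker ρ).mono
      (Finset.union_subset_union x.inSys_subset Finset.subset_union_left)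
    have hδ : Dep (x.ele ∪ (y.outSys ∪ E)) (delta x.outSys) := (dep_delta _).mono
      (x.outSys_subset.trans Finset.subset_union_left)
    refine (hδ.mul (hρ'.mul hD')).sm.mono ?_
    rw [Finset.union_sdiff_left]
    exact Finset.sdiff_subset
  have hTpk : PK T := ((pk_delta _).mul ((pk_ker_iff.2 hρ).mul hch.1)).sm
  refine ⟨ofKer _ T, ?_, ?_, ?_⟩
  · rwa [← pk_ker_iff, ker_ofKer hTdep]
  · have hT' : T = sm x.inSys (ker ρ * tr x.outSys (ker D)) := by
      rw [hT, sm_ele, sm_delta_mul, tr_mul (dep_ker ρ)]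
      exact Finset.disjoint_union_left.2 ⟨dxx, hyo_x.mono_right x.outSys_subset⟩
    have htr : tr (y.outSys ∪ E) T = 1 := by
      have dE_xi : Disjoint E x.inSys := (hEx.mono_left x.inSys_subset).symm
      have dE_yo : Disjoint E y.outSys := (hEy.mono_left y.outSys_subset).symm
      have dyx : Disjoint y.outSys x.inSys := hyo_x.mono_right x.inSys_subset
      rw [hT', tr_sm_comm (Finset.disjoint_union_left.2 ⟨dyx, dE_xi⟩), tr_union dE_yo.symm,
        tr_mul (dep_ker ρ) (Finset.disjoint_union_left.2 ⟨dE_xi.symm, dE_yo.symm⟩),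
        ← tr_union (hEx.mono_left x.outSys_subset).symm, Finset.union_comm E, hch.2,
        mul_comm, tr_mul (dep_delta _) dyx.symm, sm_delta_mul, ← tr_union dyx.symm, tr_ker, hρ1,
        one_smul]
    rw [← ker_ofKer hTdep, tr_ker] at htr
    simpa using congrFun (congrFun htr base) base
  · rw [ker_ofKer hTdep, hT, ← sm_mul (dep_delta _) hyi_x]
    congr 1
    ring

theorem chan_of_presDet (hxN : x.NoRepetition) (hyN : y.NoRepetition)
    (hxy : Disjoint x.ele y.ele)
    (hx : ∀ E, Disjoint x.ele E → Good (x.ext E)) (hy : ∀ E, Disjoint y.ele E → Good (y.ext E))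
    {D : Op (x.ele ∪ y.ele)} (hD : PresDet x y D) :
    tr (x.inSys ∪ y.outSys) (ker D) = delta (x.outSys ∪ y.inSys) := by
  have hEx := Finset.disjoint_empty_right x.ele
  have hEy := Finset.disjoint_empty_right y.ele
  have dxx := x.disjoint_in_out
  have hyi_x : Disjoint y.inSys x.ele := (hxy.mono_right y.inSys_subset).symm
  have hyo_x : Disjoint y.outSys x.ele := (hxy.mono_right y.outSys_subset).symm
  -- The test maps are `I ⊗ τ` on `x`, with no ancilla; letting the state `τ` vary separates the two
  -- kernels.
  refine ker_ext_of_states (A := x.outSys) fun τ hτ hτ1 => ?_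
  let P : Op (x.ext ∅).ele := ofKer _ (delta x.inSys * ker τ)
  have hP : ker P = delta x.inSys * ker τ := ker_ofKer (((dep_delta _).mono (by
    rw [Ty.ele_ext, Finset.union_empty]; exact x.inSys_subset)).mul ((dep_ker τ).mono (by
    rw [Ty.ele_ext, Finset.union_empty]; exact x.outSys_subset)))
  have hPdet : P ∈ detMaps (x.ext ∅) := by
    refine (hx ∅ hEx).prep P ?_
    rw [Ty.inSys_ext hxN hEx, Ty.outSys_ext hxN hEx, Finset.union_empty]
    exact ⟨τ, hτ, hτ1, hP⟩
  have key := ((hy ∅ hEy).chan _ ((completelySends_iff hxy).1 hD ∅ hEx hEy P hPdet)).2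
  rw [Ty.inSys_ext hyN hEy, Ty.outSys_ext hyN hEy, Finset.union_empty, ker_link_ext, hP,
    mul_assoc, sm_ele, sm_comm dxx, sm_delta_mul,
    tr_mul (dep_ker τ) dxx.symm, tr_sm_comm (hyo_x.mono_right x.outSys_subset),
    tr_mul (dep_ker τ) (hyo_x.mono_right x.outSys_subset).symm, ← tr_union
      (hyo_x.mono_right x.inSys_subset), Finset.union_comm] at key
  rw [key, delta_union, mul_left_comm, sm_delta_mul, mul_comm,
    tr_mul (dep_delta _) (hyi_x.mono_right x.outSys_subset), tr_ker, hτ1, one_smul, mul_one]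

theorem good_arrow (hxN : x.NoRepetition) (hyN : y.NoRepetition) (hxy : Disjoint x.ele y.ele)
    (hx : ∀ E, Disjoint x.ele E → Good (x.ext E)) (hy : ∀ E, Disjoint y.ele E → Good (y.ext E)) :
    Good (.arrow x y) where
  prep := by
    rw [Ty.inSys_arrow hxy, Ty.outSys_arrow hxy]
    rintro M ⟨ρ, hρ, hρ1, hM⟩
    refine mem_detMaps_of_presDet hxy hx hy
      (presDet_of_prep hxN hyN hxy hx hy hρ hρ1 hM) ?_
    have : PK (delta (x.outSys ∪ y.inSys) * ker ρ) := (pk_delta _).mul (pk_ker_iff.2 hρ)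
    rwa [← hM] at this
  chan := by
    rw [Ty.inSys_arrow hxy, Ty.outSys_arrow hxy]
    intro D hD
    obtain ⟨hadm, hdet⟩ := mem_detMaps_arrow.1 hD
    exact ⟨PresAdm.pk hxy hx hy (mem_admMaps_arrow.1 hadm).1,
      chan_of_presDet hxN hyN hxy hx hy hdet⟩
  pos := fun M hM => PresAdm.pk hxy hx hy (mem_admMaps_arrow.1 hM).1
  bound := by
    intro (M : Op (x.ele ∪ y.ele)) hM
    obtain ⟨hM, n, N, hN, hdet⟩ := mem_admMaps_arrow.1 hM
    have hsum : (∑ i, N i).PosSemidef := Matrix.posSemidef_sum _ fun i _ =>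
      pk_ker_iff.1 (PresAdm.pk hxy hx hy (hN i))
    have hM' := PresAdm.pk hxy hx hy hM
    refine ⟨M + ∑ i, N i, mem_detMaps_of_presDet hxy hx hy hdet ?_, ?_⟩
    · exact hM'.add (pk_ker_iff.2 hsum)
    · have : ker (M + ∑ i, N i) - ker M = ker (∑ i, N i) := by rw [ker_add, add_sub_cancel_left]
      exact this ▸ pk_ker_iff.2 hsum
  hered := by
    intro (D : Op (x.ele ∪ y.ele)) hD (M : Op (x.ele ∪ y.ele)) hM hDM
    have hdet : PresDet x y D := (mem_detMaps_arrow.1 hD).2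
    refine mem_admMaps_arrow.2 ⟨hdet.presAdm_of_le hxy hx hy hM hDM, 1, fun _ => D - M,
      fun _ => hdet.presAdm_of_le hxy hx hy hDM ?_, ?_⟩
    · change PK (ker D - ker (D - M))
      rwa [ker_sub, sub_sub_cancel]
    · have : M + ∑ _i : Fin 1, (D - M) = D := by simp
      change PresDet x y (M + ∑ _i : Fin 1, (D - M))
      rwa [this]

end Arrow

/-- The induction is on size, not on structure: the step needs the extensions `x || E` and `y || E`,
which are not subterms but have as many arrows as `x` and `y`. -/
theorem good_of_noRepetition (z : Ty) (hz : z.NoRepetition) : Good z := by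
  induction h : z.size using Nat.strong_induction_on generalizing z with
  | _ n ih =>
    cases z with
    | elem A => exact good_elem A
    | arrow x y =>
      simp only [Ty.size] at h
      exact good_arrow hz.1 hz.2.1 hz.2.2
        (fun E hE => ih x.size (by omega) _ (hz.1.ext hE) (x.size_ext E))
        (fun E hE => ih y.size (by omega) _ (hz.2.1.ext hE) (y.size_ext E))

/-! ### Operators that pair to one with all channels -/

theorem mem_detMaps_elem_iff {D : Op A} :
    D ∈ detMaps (.elem A) ↔ PK (ker D) ∧ tr A (ker D) = 1 := by
  rw [mem_detMaps_elem, pk_ker_iff, tr_ker]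
  refine and_congr_right fun _ => ⟨fun h => by rw [h, one_smul], fun h => ?_⟩
  simpa using congrFun (congrFun h base) base

theorem good_elem_ext (A E : EleType) : Good ((Ty.elem A).ext E) := good_elem _

/-- Channels are deterministic maps between elementary types. -/
theorem Chan.mem_detMaps (h : Disjoint A B) {M : Op (A ∪ B)} (hM : Chan A B (ker M)) :
    M ∈ detMaps (.arrow (.elem A) (.elem B)) := by
  refine mem_detMaps_of_presDet (x := .elem A) (y := .elem B) h (fun _ _ => good_elem_ext _ _)
    (fun _ _ => good_elem_ext _ _) ?_ hM.1
  refine (completelySends_iff (x := .elem A) (y := .elem B) h).2 fun E hA hB ρ hρ => ?_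
  change Disjoint A E at hA
  change Disjoint B E at hB
  obtain ⟨hρ, hρ1⟩ := mem_detMaps_elem_iff.1 hρ
  refine mem_detMaps_elem_iff.2 ?_
  have hk : ker (link A (B ∪ E) M ρ) = sm A (ker (A := A ∪ E) ρ * ker (A := A ∪ B) M) :=
    ker_link_ext (x := .elem A) (y := .elem B) M ρ
  change PK (ker (link A (B ∪ E) M ρ)) ∧ tr (B ∪ E) (ker (link A (B ∪ E) M ρ)) = 1
  rw [hk]
  refine ⟨(hρ.mul hM.1).sm, ?_⟩
  have dρ : Dep (A ∪ E) (ker (A := A ∪ E) ρ) := dep_ker _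
  rw [tr_sm_comm (Finset.disjoint_union_left.2 ⟨h.symm, hA.symm⟩), Finset.union_comm,
    tr_union hB.symm, tr_mul dρ (Finset.disjoint_union_left.2 ⟨h, hB.symm⟩), hM.2, mul_comm,
    tr_mul (dep_delta A) hA, sm_delta_mul, ← tr_union hA]
  exact hρ1

/-- Every positive `X` on `O ∪ I`, scaled by a small `ε`, completes to a channel by adding `(1 - ε
Tr_I X) ⊗ U`, with `U` maximally mixed on `I`. Comparison with the channel `1 ⊗ U` shows that `D`
pairs equally with `X` and with `Tr_I X ⊗ U`, so it factors as the identity on `I` times `R = d⁻¹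
Tr_I D`. -/
theorem prep_of_pairing {I O F : EleType} (hdisj : Disjoint I O) {D : Op F} (hF : F ⊆ O ∪ I)
    (hD : PK (ker D))
    (h : ∀ C : Op (O ∪ I), Chan O I (ker C) → sm (O ∪ I) (ker C * ker D) = 1) :
    Prep I O (ker D) := by
  set d : ℝ := ((Fintype.card (Config I) : ℕ) : ℝ) with hd_def
  have hd : 0 < d := Nat.cast_pos.2 (card_config_pos _)
  have hd' : (d : ℂ) ≠ 0 := by exact_mod_cast hd.ne'
  set U : Ker := ((d⁻¹ : ℝ) : ℂ) • delta I with hU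
  have hUpk : PK U := (pk_delta I).smul (inv_nonneg.2 hd.le)
  have hUtr : tr I U = 1 := by
    rw [hU, tr_smul, tr_delta, smul_smul, hd_def]
    push_cast
    rw [inv_mul_cancel₀ (by simpa [hd_def] using hd'), one_smul]
  have hUdep : Dep (O ∪ I) U := fun g k g' k' e e' => by
    simp only [hU, Pi.smul_apply, (dep_delta I).mono Finset.subset_union_right g k g' k' e e']
  have hOdep : Dep (O ∪ I) (delta O) := (dep_delta O).mono Finset.subset_union_left
  have h0 : sm (O ∪ I) (delta O * U * ker D) = 1 := by
    have := h (ofKer _ (delta O * U))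
    rw [ker_ofKer (hOdep.mul hUdep)] at this
    exact this ⟨(pk_delta O).mul hUpk, by rw [tr_mul (dep_delta O) hdisj.symm, hUtr, mul_one]⟩
  set R : Ker := ((d⁻¹ : ℝ) : ℂ) • tr I (ker D) with hR
  have hRdep : Dep O R := by
    have : Dep O (tr I (ker D)) := (((dep_ker D).mono hF).tr).mono (by
      rw [Finset.union_sdiff_right]; exact Finset.sdiff_subset)
    intro g k g' k' e e'
    simp only [hR, Pi.smul_apply, this g k g' k' e e']
  have split : ∀ Z : Ker, sm (O ∪ I) Z = sm O (sm I Z) := fun Z => sm_union hdisj.symm Z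
  have key : ker D = delta I * R := by
    refine ker_ext_of_pure (A := O ∪ I) fun ψ => ?_
    set X : Ker := fun g g' => ψ (rst (O ∪ I) g) * star (ψ (rst (O ∪ I) g')) with hX
    have hXpk : PK X := pk_outer fun g => ψ (rst (O ∪ I) g)
    have hXdep : Dep (O ∪ I) X := fun g k g' k' e e' => by simp only [hX, e, e']
    have hTdep : Dep O (tr I X) := hXdep.tr.mono (by
      rw [Finset.union_sdiff_right]; exact Finset.sdiff_subset)
    obtain ⟨c, hc, hcT⟩ := exists_smul_one_sub_posSemidef (M := ofKer O (tr I X))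
      (pk_ker_iff.1 (by rw [ker_ofKer hTdep]; exact hXpk.tr))
    have hc' : (c : ℂ) ≠ 0 := by exact_mod_cast hc.ne'
    have hcT := pk_ker_iff.2 hcT
    rw [ker_sub, ker_smul, ker_one, ker_ofKer hTdep] at hcT
    set ε : ℂ := ((c⁻¹ : ℝ) : ℂ) with hε
    have hε0 : ε ≠ 0 := by rw [hε]; exact_mod_cast (inv_pos.2 hc).ne'
    -- With `ε = 1/c` and `Tr_I X ≤ c`, the complement `Y` is positive.
    set Y : Ker := delta O - ε • tr I X with hY
    have hYpk : PK Y := by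
      have := hcT.smul (inv_nonneg.2 hc.le)
      rw [smul_sub, smul_smul] at this
      rwa [← hε, hε, Complex.ofReal_inv, inv_mul_cancel₀ hc', one_smul, ← Complex.ofReal_inv] at this
    have hYdep : Dep O Y := fun g k g' k' e e' => by
      simp only [hY, Pi.sub_apply, Pi.smul_apply, dep_delta O g k g' k' e e',
        hTdep g k g' k' e e']
    have hCdep : Dep (O ∪ I) (ε • X + Y * U) := fun g k g' k' e e' => by
      simp only [Pi.add_apply, Pi.smul_apply, Pi.mul_apply, hXdep g k g' k' e e',
        hYdep.mono Finset.subset_union_left g k g' k' e e', hUdep g k g' k' e e']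
    have h1 := h (ofKer _ (ε • X + Y * U))
    rw [ker_ofKer hCdep] at h1
    have h1 := h1 ⟨(hXpk.smul (inv_nonneg.2 hc.le)).add (hYpk.mul hUpk), by
      rw [tr_add, tr_smul, tr_mul hYdep hdisj.symm, hUtr, mul_one, hY]; ring⟩
    have e1 : (ε • X + Y * U) * ker D =
        delta O * U * ker D + ε • (X * ker D - tr I X * U * ker D) := by
      rw [hY, smul_sub]
      simp only [← smul_mul_assoc]
      ring
    rw [e1, sm_add, h0, sm_smul, sm_sub, add_eq_left, smul_eq_zero_iff_right hε0, sub_eq_zero] at h1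
    rw [h1, split, split]
    congr 1
    have e2 : tr I X * U * ker D = tr I X * (delta I * (((d⁻¹ : ℝ) : ℂ) • ker D)) := by
      simp only [hU, mul_assoc, smul_mul_assoc, mul_smul_comm]
    rw [e2, sm_mul hTdep hdisj.symm, sm_delta_mul, tr_smul, ← hR, mul_left_comm, sm_delta_mul,
      mul_comm X, tr_mul hRdep hdisj.symm, mul_comm]
  refine ⟨ofKer O R, ?_, ?_, by rw [ker_ofKer hRdep]; exact key⟩
  · rw [← pk_ker_iff, ker_ofKer hRdep]
    exact hD.tr.smul (inv_nonneg.2 hd.le)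
  · have hRtr : tr O R = 1 := by
      rw [split, mul_assoc, sm_mul (dep_delta O) hdisj.symm, sm_delta_mul, hU, smul_mul_assoc,
        sm_smul, sm_delta_mul] at h0
      exact h0
    rw [← ker_ofKer hRdep, tr_ker] at hRtr
    simpa using congrFun (congrFun hRtr base) base

/-! ### The inclusions of types -/

/-- A type is included in `x` if its deterministic maps discard the inputs of `x` and prepare
a state of the outputs of `x`. -/
theorem included_of_prep {z x : Ty} (hz : z.NoRepetition) (hx : x.NoRepetition)
    (e : z.ele = x.ele) (h : ∀ D ∈ detMaps z, Prep x.inSys x.outSys (ker D)) : Included z x := by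
  refine ⟨e, fun M hM => ?_⟩
  obtain ⟨D, hD, hDM⟩ := (good_of_noRepetition z hz).bound M hM
  exact (good_of_noRepetition x hx).hered (castOp e D)
    ((good_of_noRepetition x hx).prep _ (h D hD)) _
    ((good_of_noRepetition z hz).pos M hM) hDM

/-- Deterministic maps of type `w → I` give the value one on the deterministic maps of type `w`. -/
theorem pairing_bar {w : Ty} {D : Op (w.ele ∪ ∅)}
    (hD : D ∈ detMaps (.bar w)) {C : Op (w.ext ∅).ele} (hC : C ∈ detMaps (w.ext ∅)) :
    sm w.ele (ker C * ker D) = 1 := by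
  have hdet := (completelySends_iff (x := w) (y := .triv) (Finset.disjoint_empty_right _)).1
    (mem_detMaps_arrow.1 hD).2 ∅ (Finset.disjoint_empty_right _) (Finset.disjoint_empty_right _)
    C hC
  have := (mem_detMaps_elem_iff.1 hdet).2
  have hk := ker_link_ext (x := w) (y := .triv) (E := ∅) D C
  exact hk.symm.trans ((tr_empty _).symm.trans this)

theorem included_bar (x : Ty) (hx : x.NoRepetition) :
    Included (Ty.bar (.arrow (.elem x.outSys) (.elem x.inSys))) x := by
  have hz : (Ty.bar (.arrow (.elem x.outSys) (.elem x.inSys))).NoRepetition :=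
    ⟨⟨trivial, trivial, x.disjoint_in_out.symm⟩, trivial, Finset.disjoint_empty_right _⟩
  have hele : x.outSys ∪ x.inSys = x.ele := by rw [Finset.union_comm, x.in_union_out]
  refine included_of_prep hz hx ?_ fun D hD => ?_
  · change x.outSys ∪ x.inSys ∪ ∅ = x.ele
    rw [Finset.union_empty, hele]
  · refine prep_of_pairing x.disjoint_in_out (Finset.union_empty _).subset
      ((good_of_noRepetition _ hz).chan D hD).1 fun C hC => ?_
    refine pairing_bar (w := .arrow (.elem x.outSys) (.elem x.inSys)) hD
      (C := castOp (congrArg (x.outSys ∪ ·) (Finset.union_empty x.inSys).symm) C) ?_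
    refine Chan.mem_detMaps (B := x.inSys ∪ ∅) ?_ ?_
    · rw [Finset.union_empty]; exact x.disjoint_in_out.symm
    · change Chan x.outSys (x.inSys ∪ ∅) (ker C)
      rwa [Finset.union_empty]

/-- The tensor type is the bar of `Ī → Ō`, and a channel `C` from `O` to `I` is a deterministic map
of `Ī → Ō` by acting in the Heisenberg picture. So `prep_of_pairing` applies again. -/
theorem included_tensor (x : Ty) (hx : x.NoRepetition) :
    Included (Ty.tensor (Ty.bar (.elem x.inSys)) (.elem x.outSys)) x := by
  set I := x.inSys
  set O := x.outSys
  have hdisj : Disjoint I O := x.disjoint_in_out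
  have hz : (Ty.tensor (Ty.bar (.elem I)) (.elem O)).NoRepetition := by
    refine ⟨⟨⟨trivial, trivial, Finset.disjoint_empty_right _⟩,
      ⟨trivial, trivial, Finset.disjoint_empty_right _⟩, ?_⟩, trivial,
      Finset.disjoint_empty_right _⟩
    change Disjoint (I ∪ ∅) (O ∪ ∅)
    simpa using hdisj
  have hele : O ∪ I = (I ∪ ∅) ∪ (O ∪ (∅ ∪ ∅)) := by simp [Finset.union_comm]
  refine included_of_prep hz hx ?_ fun D hD => ?_
  · change (I ∪ ∅) ∪ (O ∪ ∅) ∪ ∅ = x.ele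
    simpa using x.in_union_out
  · refine prep_of_pairing hdisj ?_
      ((good_of_noRepetition _ hz).chan D hD).1 fun C hC => ?_
    · change (I ∪ ∅) ∪ (O ∪ ∅) ∪ ∅ ⊆ O ∪ I
      simp [Finset.union_comm]
    have hsm : ∀ Z : Ker, sm (O ∪ I) Z = sm ((I ∪ ∅) ∪ (O ∪ ∅)) Z := fun Z => by
      rw [Finset.union_empty, Finset.union_empty, Finset.union_comm]
    refine (hsm _).trans (pairing_bar (w := .arrow (.bar (.elem I)) (.bar (.elem O))) hD
      (C := castOp hele C) ?_)
    have hx1 : (Ty.bar (.elem I)).NoRepetition := ⟨trivial, trivial, Finset.disjoint_empty_right _⟩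
    have hy1 : (Ty.arrow (.elem O) (.elem (∅ ∪ ∅))).NoRepetition :=
      ⟨trivial, trivial, Finset.disjoint_empty_right _⟩
    have hxy : Disjoint (Ty.bar (.elem I)).ele (Ty.arrow (.elem O) (.elem (∅ ∪ ∅))).ele := by
      change Disjoint (I ∪ ∅) (O ∪ (∅ ∪ ∅))
      simpa using hdisj
    refine mem_detMaps_of_presDet (x := .bar (.elem I)) (y := .arrow (.elem O) (.elem (∅ ∪ ∅)))
      hxy (fun E hE => good_of_noRepetition _ (hx1.ext hE))
      (fun E hE => good_of_noRepetition _ (hy1.ext hE)) ?_ hC.1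
    -- Here `X` is a channel from `I` to `E`, and the contraction is its composition with `C`, a
    -- channel from `O` to `E`.
    refine (completelySends_iff hxy).2 fun E hE hE' X hX => ?_
    have hIE : Disjoint I E := by
      have : Disjoint (I ∪ ∅) E := hE
      simpa using this
    have hOE : Disjoint O E := by
      have : Disjoint (O ∪ (∅ ∪ ∅)) E := hE'
      simpa using this
    obtain ⟨hXpk, hXtr⟩ := (good_of_noRepetition _ (hx1.ext hE)).chan X hX
    rw [Ty.inSys_ext hx1 hE, Ty.outSys_ext hx1 hE] at hXtr
    change tr ((Ty.arrow (.elem I) (.elem ∅)).outSys ∪ E) _ =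
      delta (Ty.arrow (.elem I) (.elem ∅)).inSys at hXtr
    rw [Ty.inSys_arrow (Finset.disjoint_empty_right _),
      Ty.outSys_arrow (Finset.disjoint_empty_right _), Ty.inSys_elem, Ty.outSys_elem, Ty.inSys_elem, Ty.outSys_elem] at hXtr
    simp only [Finset.union_empty, Finset.empty_union] at hXtr
    have hk := ker_link_ext (x := .bar (.elem I)) (y := .arrow (.elem O) (.elem (∅ ∪ ∅))) (E := E)
      (castOp hele C) X
    refine Chan.mem_detMaps (A := O) (B := (∅ ∪ ∅) ∪ E) (by simpa using hOE) ?_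
    have goal : Chan O ((∅ ∪ ∅) ∪ E) (sm (I ∪ ∅) (ker X * ker C)) := by
      refine ⟨(hXpk.mul hC.1).sm, ?_⟩
      simp only [Finset.union_empty, Finset.empty_union]
      rw [tr_sm_comm hIE.symm, mul_comm, tr_mul (dep_ker C)
        (Finset.disjoint_union_left.2 ⟨hOE, hIE⟩), hXtr, mul_comm, sm_delta_mul, hC.2]
    exact hk ▸ goal

theorem isChannel_iff (h : Disjoint A B) {M : Op (A ∪ B)} :
    IsChannel A B M ↔ Chan A B (ker M) := by
  rw [IsChannel, Chan, pk_ker_iff]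
  have e : ∀ (g : Glob) (b : Config B), glue (rst A g) b = rst (A ∪ B) (upd g b) := fun g b => by
    rw [← glue_rst, rst_upd, rst_upd_of_disjoint h]
  refine and_congr_right fun _ => ⟨fun hM => ?_, fun hM => ?_⟩
  · rw [← ker_one, ← hM]
    funext g g'
    simp only [tr, ker, e]
  · apply ker_injective
    rw [ker_one, ← hM]
    funext g g'
    simp only [tr, ker, e]

theorem ker_discardPrepare (ρ : Op B) : ker (discardPrepare A ρ) = delta A * ker ρ := by
  rw [← ker_one]; rfl

end HOQT

open HOQT
theorem mainTheorem5 (x : Ty) (hx : x.NoRepetition) :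
    Included (Ty.bar (.arrow (.elem x.outSys) (.elem x.inSys))) x ∧
    Included (Ty.tensor (Ty.bar (.elem x.inSys)) (.elem x.outSys)) x ∧
    Included x (.arrow (.elem x.inSys) (.elem x.outSys)) ∧
    (∀ ρ : Op x.outSys, ρ.PosSemidef → ρ.trace = 1 →
      castOp x.in_union_out (discardPrepare x.inSys ρ) ∈ detMaps x) ∧
    (∀ D ∈ detMaps x, IsChannel x.inSys x.outSys (castOp x.in_union_out.symm D)) ∧
    (∀ M ∈ admMaps x, M.PosSemidef ∧ ∃ D : Op x.ele,
      IsChannel x.inSys x.outSys (castOp x.in_union_out.symm D) ∧ (D - M).PosSemidef) := by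
  have good := good_of_noRepetition x hx
  have dio := x.disjoint_in_out
  have hchan : ∀ D ∈ detMaps x, IsChannel x.inSys x.outSys (castOp x.in_union_out.symm D) :=
    fun D hD => (isChannel_iff dio).2 (good.chan D hD)
  refine ⟨included_bar x hx, included_tensor x hx, ⟨x.in_union_out.symm, fun M hM => ?_⟩,
    fun ρ hρ hρ1 => good.prep _ ⟨ρ, hρ, hρ1, ker_discardPrepare ρ⟩, hchan, fun M hM => ?_⟩
  · obtain ⟨D, hD, hDM⟩ := good.bound M hM
    have hg : Good (.arrow (.elem x.inSys) (.elem x.outSys)) :=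
      good_of_noRepetition _ ⟨trivial, trivial, dio⟩
    exact hg.hered (castOp x.in_union_out.symm D)
      (Chan.mem_detMaps dio (good.chan D hD)) _ (good.pos M hM) hDM
  · obtain ⟨D, hD, hDM⟩ := good.bound M hM
    exact ⟨pk_ker_iff.1 (good.pos M hM), D, hchan D hD, pk_ker_iff.1 hDM⟩
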